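/- Let $c$ be a real constant and let $e:\mathbb{N}\to\mathbb{R}$ be a function with $e(n)\to 0$ as $n\to\infty$. Then there is a function $f:\mathbb{N}\to\mathbb{R}$ with $f(n)=o(n)$, depending only on $c$ and $e$, such that the following holds. If $G$ is a finite $r$-regular bipartite simple graph on $n$ vertices and $r=n^{c-\delta}$ for some real $\delta$ with $|\delta|\le e(n)$, then $G$ has at least $n^{\frac{c}{2}n-f(n)}$ perfect matchings. In asymptotic notation: if $c$ is a constant, $r=n^{c-o(1)}$, and $G$ is an $r$-regular bipartite graph on $n$ vertices, then $G$ contains at least $n^{\frac{c}{2}n-o(n)}$ perfect matchings. -/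

import Mathlib

open Filter Topology Asymptotics

/-! In a bipartite `r`-regular graph the two sides have equal size `m = n / 2`, and the biadjacency
matrix divided by `r` is doubly stochastic. Its permanent is `r ^ (-m)` times the number of perfect
matchings, so a bound `exp (-m)` on such permanents gives at least `(r / e) ^ (n / 2)` matchings.
Substituting `r = n ^ (c - δ)`, the losses `n ^ (-δ n / 2)` and `exp (-n / 2)` are both absorbed in
`n ^ (-f n)`.

The permanent bound is Gurvits' capacity argument. The permanent is the mixed derivative of `∏ X i`
along the columns of the matrix (`iterDirDeriv_prod_X`). Differentiating in a positive direction
keeps a homogeneous polynomial stable (`IsStable.dirDeriv`), and real-rootedness on lines means that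
each derivative costs at most a factor `e` of capacity (`IsStable.le_exp_one_mul_dirDeriv`). The
initial capacity is at least 1 by weighted AM-GM. -/

namespace MvPolynomial

/-! ### Stable homogeneous polynomials and directional derivatives -/

variable {σ K : Type*}

/-- The derivative in the direction `a`. -/
noncomputable def dirDeriv (a : σ → ℝ) : Derivation ℝ (MvPolynomial σ ℝ) (MvPolynomial σ ℝ) :=
  mkDerivation ℝ fun i => C (a i)

/-- The restriction of a polynomial to the line `t ↦ b + t a`. -/
noncomputable def restrictLine [Field K] [Algebra ℝ K] (b a : σ → K) :
    MvPolynomial σ ℝ →ₐ[ℝ] Polynomial K :=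
  aeval fun i => Polynomial.C (b i) + Polynomial.C (a i) * Polynomial.X

theorem eval_restrictLine [Field K] [Algebra ℝ K] (b a : σ → K) (f : MvPolynomial σ ℝ) (t : K) :
    (restrictLine b a f).eval t = aeval (b + t • a) f := by
  have : ((Polynomial.aeval t).restrictScalars ℝ).comp (restrictLine b a) =
      (aeval (b + t • a) : MvPolynomial σ ℝ →ₐ[ℝ] K) := by
    ext i
    simp only [restrictLine, AlgHom.comp_apply, aeval_X, AlgHom.restrictScalars_apply,
      Polynomial.coe_aeval_eq_eval, Polynomial.eval_add, Polynomial.eval_mul, Polynomial.eval_C,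
      Polynomial.eval_X, Pi.add_apply, Pi.smul_apply, smul_eq_mul, mul_comm]
  simpa using congr($this f)

theorem derivative_restrictLine [Field K] [Algebra ℝ K] (b : σ → K) (a : σ → ℝ)
    (f : MvPolynomial σ ℝ) :
    (restrictLine b (fun i => algebraMap ℝ K (a i)) f).derivative =
      restrictLine b (fun i => algebraMap ℝ K (a i)) (dirDeriv a f) := by
  induction f using MvPolynomial.induction_on with
  | C r =>
    rw [show (C r : MvPolynomial σ ℝ) = algebraMap ℝ _ r from rfl, AlgHom.commutes,
      Derivation.map_algebraMap, map_zero, IsScalarTower.algebraMap_apply ℝ K (Polynomial K)]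
    exact Polynomial.derivative_C
  | add p q hp hq => simp only [map_add, hp, hq]
  | mul_X p i hp =>
    have hX : (restrictLine b (fun i => algebraMap ℝ K (a i)) (X i)).derivative =
        restrictLine b (fun i => algebraMap ℝ K (a i)) (C (a i)) := by
      rw [show (C (a i) : MvPolynomial σ ℝ) = algebraMap ℝ _ (a i) from rfl, AlgHom.commutes,
        IsScalarTower.algebraMap_apply ℝ K (Polynomial K)]
      simp [restrictLine]
    have hD : dirDeriv a (X i) = C (a i) := mkDerivation_X _ _ _
    rw [map_mul, Polynomial.derivative_mul, hp, hX, Derivation.leibniz, hD]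
    simp only [smul_eq_mul, map_add, map_mul]
    ring

theorem IsHomogeneous.dirDeriv [Fintype σ] {f : MvPolynomial σ ℝ} {k : ℕ}
    (hf : f.IsHomogeneous (k + 1)) (a : σ → ℝ) : (dirDeriv a f).IsHomogeneous k := by
  classical
  have hsum : ∀ g : MvPolynomial σ ℝ, (∑ i, (C (a i) : MvPolynomial σ ℝ) •
      (pderiv i : Derivation ℝ _ (MvPolynomial σ ℝ))) g = ∑ i, C (a i) * pderiv i g := fun g => by
    induction (Finset.univ : Finset σ) using Finset.induction_on with
    | empty => simp
    | insert i s hi ih => rw [Finset.sum_insert hi, Finset.sum_insert hi, ← ih]; rfl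
  have h : MvPolynomial.dirDeriv a =
      ∑ i, (C (a i) : MvPolynomial σ ℝ) • (pderiv i : Derivation ℝ _ (MvPolynomial σ ℝ)) := by
    refine MvPolynomial.derivation_ext fun i => ?_
    rw [hsum, MvPolynomial.dirDeriv, mkDerivation_X]
    simp [pderiv_X, Pi.single_apply]
  rw [h, hsum]
  exact IsHomogeneous.sum _ _ _ fun i _ => hf.pderiv.C_mul _

theorem aeval_smul_of_isHomogeneous [Field K] [Algebra ℝ K] {f : MvPolynomial σ ℝ}
    {k : ℕ} (hf : f.IsHomogeneous k) (c : K) (z : σ → K) :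
    aeval (c • z) f = c ^ k * aeval z f := by
  rw [aeval_def, aeval_def, eval₂_eq, eval₂_eq, Finset.mul_sum]
  refine Finset.sum_congr rfl fun d hd => ?_
  simp_rw [Pi.smul_apply, smul_eq_mul, mul_pow]
  rw [Finset.prod_mul_distrib, Finset.prod_pow_eq_pow_sum, hf.degree_eq_sum_deg_support hd]
  ring

/-- A real polynomial is stable if it has no zeros in the open upper half space. -/
def IsStable (f : MvPolynomial σ ℝ) : Prop :=
  ∀ z : σ → ℂ, (∀ i, 0 < (z i).im) → aeval z f ≠ 0

theorem isStable_prod_X [Fintype σ] : IsStable (∏ i : σ, X i) := fun z hz => by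
  rw [map_prod, Finset.prod_ne_zero_iff]
  intro i _ h
  rw [aeval_X] at h
  simpa [h] using hz i

theorem aeval_ofReal (x : σ → ℝ) (f : MvPolynomial σ ℝ) :
    aeval (fun i => (x i : ℂ)) f = ((aeval x f : ℝ) : ℂ) := by
  have : (aeval (fun i => (x i : ℂ)) : MvPolynomial σ ℝ →ₐ[ℝ] ℂ) =
      Complex.ofRealAm.comp (aeval x) := by
    ext i
    simp
  simpa using congr($this f)

/-- Multiplication by `I` moves a positive point into the upper half space and only scales `f`. -/
theorem IsStable.aeval_ne_zero {f : MvPolynomial σ ℝ} {k : ℕ} (hs : IsStable f)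
    (hf : f.IsHomogeneous k) {x : σ → ℝ} (hx : ∀ i, 0 < x i) : aeval x f ≠ 0 := fun h => by
  refine hs (Complex.I • fun i => (x i : ℂ)) (fun i => by simpa using hx i) ?_
  rw [aeval_smul_of_isHomogeneous hf, aeval_ofReal, h]
  simp

/-- If `f (z + t a)` were a constant `c`, homogeneity would give `f (a + t z) = c t ^ (k + 1)`, so
`f a = 0` at `t = 0`, impossible for positive `a`. -/
theorem IsStable.natDegree_restrictLine_pos {f : MvPolynomial σ ℝ} {k : ℕ} (hs : IsStable f)
    (hf : f.IsHomogeneous (k + 1)) {a : σ → ℝ} (ha : ∀ i, 0 < a i) (z : σ → ℂ) :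
    0 < (restrictLine z (fun i => (a i : ℂ)) f).natDegree := by
  by_contra! h0
  obtain ⟨c, hc⟩ := Polynomial.natDegree_eq_zero.1 (Nat.le_zero.1 h0)
  have key : restrictLine (fun i => (a i : ℂ)) z f = Polynomial.C c * Polynomial.X ^ (k + 1) := by
    refine Polynomial.eq_of_infinite_eval_eq _ _ (Set.Infinite.mono (s := {0}ᶜ) ?_ ?_)
    · intro t (ht : t ≠ 0)
      have h1 : (restrictLine z (fun i => (a i : ℂ)) f).eval t⁻¹ = c := by rw [← hc]; simp
      rw [eval_restrictLine] at h1
      have h2 : (fun i => (a i : ℂ)) + t • z = t • (z + t⁻¹ • fun i => (a i : ℂ)) := by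
        rw [smul_add, smul_smul, mul_inv_cancel₀ ht, one_smul, add_comm]
      change Polynomial.eval t _ = Polynomial.eval t _
      rw [eval_restrictLine, h2, aeval_smul_of_isHomogeneous hf, h1]
      rw [Polynomial.eval_mul, Polynomial.eval_C, Polynomial.eval_pow, Polynomial.eval_X, mul_comm]
    · exact (Set.finite_singleton (0 : ℂ)).infinite_compl
  have h1 := eval_restrictLine (fun i => (a i : ℂ)) z f 0
  rw [key, zero_smul, add_zero, aeval_ofReal] at h1
  refine hs.aeval_ne_zero hf ha ?_
  have : (0 : ℂ) = ((aeval a f : ℝ) : ℂ) := by simpa using h1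
  exact_mod_cast this.symm

/-- Gauss–Lucas: the zeros of `t ↦ f (z + t a)` lie in the open lower half plane, hence so do its
critical points, and 0 is not among them. -/
theorem IsStable.dirDeriv {f : MvPolynomial σ ℝ} {k : ℕ} (hs : IsStable f)
    (hf : f.IsHomogeneous (k + 1)) {a : σ → ℝ} (ha : ∀ i, 0 < a i) :
    IsStable (dirDeriv a f) := by
  intro z hz h
  set P := restrictLine z (fun i => (a i : ℂ)) f with hP
  have hdeg : 0 < P.degree :=
    Polynomial.natDegree_pos_iff_degree_pos.1 (hs.natDegree_restrictLine_pos hf ha z)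
  have hd : P.derivative ≠ 0 := by
    rw [Ne, Polynomial.derivative_eq_zero]
    exact (hs.natDegree_restrictLine_pos hf ha z).ne'
  have hder : P.derivative = restrictLine z (fun i => (a i : ℂ)) (MvPolynomial.dirDeriv a f) :=
    derivative_restrictLine z a f
  have h0 : (0 : ℂ) ∈ P.derivative.rootSet ℂ := by
    rw [Polynomial.mem_rootSet]
    refine ⟨hd, ?_⟩
    rw [Polynomial.coe_aeval_eq_eval, hder, eval_restrictLine]
    simpa using h
  have h1 := Polynomial.rootSet_derivative_subset_convexHull_rootSet hdeg h0
  have h2 : P.rootSet ℂ ⊆ {w : ℂ | w.im < 0} := by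
    intro w hw
    rw [Polynomial.mem_rootSet, Polynomial.coe_aeval_eq_eval, eval_restrictLine] at hw
    by_contra hn
    have hw0 : 0 ≤ w.im := by simpa using hn
    refine hs _ (fun i => ?_) hw.2
    have := mul_nonneg hw0 (ha i).le
    have := hz i
    simp
    linarith
  have h3 := convexHull_min h2 (convex_halfSpace_im_lt 0) h1
  simp at h3

/-- Homogeneity makes stability symmetric under negation, so roots in either half plane are
excluded. -/
theorem IsStable.im_eq_zero_of_root {f : MvPolynomial σ ℝ} {k : ℕ} (hs : IsStable f)
    (hf : f.IsHomogeneous k) {a b : σ → ℝ} (ha : ∀ i, 0 < a i) {z : ℂ}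
    (hz : aeval ((fun i => (b i : ℂ)) + z • fun i => (a i : ℂ)) f = 0) : z.im = 0 := by
  rcases lt_trichotomy z.im 0 with h | h | h
  · exfalso
    refine hs ((-1 : ℂ) • ((fun i => (b i : ℂ)) + z • fun i => (a i : ℂ))) (fun i => ?_) ?_
    · have := mul_neg_of_neg_of_pos h (ha i)
      simpa using this
    · rw [aeval_smul_of_isHomogeneous hf, hz, mul_zero]
  · exact h
  · exfalso
    refine hs _ (fun i => ?_) hz
    simpa using mul_pos h (ha i)

theorem restrictLine_map_ofReal (a b : σ → ℝ) (f : MvPolynomial σ ℝ) :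
    (restrictLine b a f).map Complex.ofRealHom =
      restrictLine (fun i => (b i : ℂ)) (fun i => (a i : ℂ)) f := by
  have : (Polynomial.mapAlgHom Complex.ofRealAm).comp (restrictLine b a) =
      restrictLine (fun i => (b i : ℂ)) (fun i => (a i : ℂ)) := by
    ext i : 1
    simp [restrictLine]
  exact congr($this f)

theorem IsStable.splits_restrictLine {f : MvPolynomial σ ℝ} {k : ℕ} (hs : IsStable f)
    (hf : f.IsHomogeneous k) {a b : σ → ℝ} (ha : ∀ i, 0 < a i) :
    (restrictLine b a f).Splits := by
  refine Polynomial.Splits.of_splits_map Complex.ofRealHom (IsAlgClosed.splits _) fun z hz => ?_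
  rw [restrictLine_map_ofReal] at hz
  have h := Polynomial.isRoot_of_mem_roots hz
  rw [Polynomial.IsRoot, eval_restrictLine] at h
  have := hs.im_eq_zero_of_root hf ha h
  exact ⟨z.re, Complex.ext (by simp) (by simp [this])⟩

end MvPolynomial

/-! ### Capacity in one variable -/

namespace Polynomial

/-- Apply `1 + x ≤ exp x` to each factor `1 + t / (-r)`; the exponents add up to `t` times the
logarithmic derivative at 0. -/
theorem eval_multiset_prod_le_exp (s : Multiset ℝ) (hs : ∀ r ∈ s, r < 0) :
    0 < ((s.map fun r => X - C r).prod).eval 0 ∧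
      0 ≤ ((s.map fun r => X - C r).prod).derivative.eval 0 ∧
      ∀ t, 0 ≤ t → ((s.map fun r => X - C r).prod).eval t ≤
        ((s.map fun r => X - C r).prod).eval 0 *
          Real.exp (t * (((s.map fun r => X - C r).prod).derivative.eval 0 /
            ((s.map fun r => X - C r).prod).eval 0)) := by
  induction s using Multiset.induction_on with
  | empty => simp
  | cons r s ih =>
    obtain ⟨h1, h2, h3⟩ := ih fun x hx => hs x (Multiset.mem_cons_of_mem hx)
    have hr : r < 0 := hs r (Multiset.mem_cons_self r s)
    rw [Multiset.map_cons, Multiset.prod_cons]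
    set q := (s.map fun r => X - C r).prod
    have e0 : ((X - C r) * q).eval 0 = -r * q.eval 0 := by simp
    have e1 : ((X - C r) * q).derivative.eval 0 = q.eval 0 + -r * q.derivative.eval 0 := by simp
    rw [e0, e1]
    have hr' : 0 < -r := by linarith
    refine ⟨mul_pos hr' h1, by positivity, fun t ht => ?_⟩
    have e2 : t * ((q.eval 0 + -r * q.derivative.eval 0) / (-r * q.eval 0)) =
        t / -r + t * (q.derivative.eval 0 / q.eval 0) := by
      generalize -r = u at hr'
      field_simp
    rw [e2, Real.exp_add]
    have e3 : ((X - C r) * q).eval t = (t - r) * q.eval t := by simp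
    have e4 : t - r ≤ -r * Real.exp (t / -r) := by
      have := Real.add_one_le_exp (t / -r)
      calc t - r = -r * (t / -r + 1) := by rw [mul_add, mul_div_cancel₀ _ hr'.ne']; ring
        _ ≤ _ := by gcongr
    calc ((X - C r) * q).eval t = (t - r) * q.eval t := e3
      _ ≤ (-r * Real.exp (t / -r)) *
          (q.eval 0 * Real.exp (t * (q.derivative.eval 0 / q.eval 0))) :=
        (mul_le_mul_of_nonneg_left (h3 t ht) (by linarith)).trans
          (mul_le_mul_of_nonneg_right e4 (by positivity))
      _ = _ := by ring

/-- The one-variable capacity inequality. -/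
theorem Splits.le_exp_one_mul_derivative {p : ℝ[X]} (hp : p.Splits)
    (hroots : ∀ r ∈ p.roots, r < 0) (h0 : 0 < p.eval 0) {c : ℝ}
    (hc : ∀ t, 0 < t → c * t ≤ p.eval t) : c ≤ Real.exp 1 * p.derivative.eval 0 := by
  obtain ⟨h1, h2, h3⟩ := eval_multiset_prod_le_exp p.roots hroots
  have hprod := hp.eq_prod_roots
  set q := (p.roots.map fun r => X - C r).prod
  set l := p.leadingCoeff
  have e0 : p.eval 0 = l * q.eval 0 := by rw [hprod]; simp
  have e1 : p.derivative.eval 0 = l * q.derivative.eval 0 := by rw [hprod]; simp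
  have hl : 0 < l := by
    rw [e0] at h0
    exact pos_of_mul_pos_left h0 h1.le
  have e2 : ∀ t, p.eval t = l * q.eval t := fun t => by rw [hprod]; simp
  -- If the derivative at 0 vanishes, `p` is bounded on `t ≥ 0`, which rules out linear growth with
  -- `c > 0`.
  rcases h2.eq_or_lt with h | h
  · rw [e1, ← h]
    by_contra! hcpos
    simp only [mul_zero] at hcpos
    have hb : ∀ t, 0 < t → c * t ≤ l * q.eval 0 := fun t ht => by
      refine (hc t ht).trans ?_
      rw [e2]
      have := h3 t ht.le
      rw [← h] at this
      gcongr
      simpa using this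
    have := hb ((l * q.eval 0 + 1) / c) (by positivity)
    rw [mul_div_cancel₀ _ hcpos.ne'] at this
    linarith
  -- This `t` makes the exponent equal to 1.
  · set t := q.eval 0 / q.derivative.eval 0 with ht
    have htpos : 0 < t := by positivity
    have h4 := h3 t htpos.le
    have h5 : t * (q.derivative.eval 0 / q.eval 0) = 1 := by rw [ht]; field_simp
    rw [h5] at h4
    have h6 := hc t htpos
    rw [e2] at h6
    have h7 : q.eval 0 = t * q.derivative.eval 0 := by rw [ht]; field_simp
    have h8 : c * t ≤ (Real.exp 1 * (l * q.derivative.eval 0)) * t := by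
      calc c * t ≤ l * q.eval t := h6
        _ ≤ l * (q.eval 0 * Real.exp 1) := by gcongr
        _ = _ := by rw [h7]; ring
    rw [e1]
    exact le_of_mul_le_mul_right h8 htpos

end Polynomial

/-! ### Iterated capacity and the mixed derivative -/

namespace MvPolynomial

variable {σ : Type*}

theorem IsStable.le_exp_one_mul_dirDeriv {f : MvPolynomial σ ℝ} {k : ℕ} (hs : IsStable f)
    (hf : f.IsHomogeneous k) {a b : σ → ℝ} (ha : ∀ i, 0 < a i) (hb : ∀ i, 0 < b i)
    (hpos : 0 < aeval b f) {c : ℝ} (hc : ∀ t : ℝ, 0 < t → c * t ≤ aeval (b + t • a) f) :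
    c ≤ Real.exp 1 * aeval b (MvPolynomial.dirDeriv a f) := by
  have hroots : ∀ r ∈ (restrictLine b a f).roots, r < 0 := fun r hr => by
    have h := Polynomial.isRoot_of_mem_roots hr
    rw [Polynomial.IsRoot, eval_restrictLine] at h
    by_contra! h0
    exact hs.aeval_ne_zero hf
      (fun i => add_pos_of_pos_of_nonneg (hb i) (mul_nonneg h0 (ha i).le)) h
  have h0 : (restrictLine b a f).eval 0 = aeval b f := by rw [eval_restrictLine]; simp
  have h1 : (restrictLine b a f).derivative.eval 0 = aeval b (MvPolynomial.dirDeriv a f) := by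
    have := derivative_restrictLine (K := ℝ) b a f
    simp only [Algebra.algebraMap_self, RingHom.id_apply] at this
    rw [this, eval_restrictLine]; simp
  rw [← h1]
  refine (hs.splits_restrictLine hf ha).le_exp_one_mul_derivative hroots (h0 ▸ hpos)
    fun t ht => ?_
  rw [eval_restrictLine]
  exact hc t ht

/-- The iterated directional derivative along the columns `a 0, …, a (k - 1)`. -/
noncomputable def iterDirDeriv : (k : ℕ) → (Fin k → σ → ℝ) →
    MvPolynomial σ ℝ →ₗ[ℝ] MvPolynomial σ ℝ
  | 0, _ => LinearMap.id
  | k + 1, a => (iterDirDeriv k (Fin.tail a)).comp (dirDeriv (a 0)).toLinearMap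

theorem iterDirDeriv_succ {k : ℕ} (a : Fin (k + 1) → σ → ℝ) (f : MvPolynomial σ ℝ) :
    iterDirDeriv (k + 1) a f = iterDirDeriv k (Fin.tail a) (dirDeriv (a 0) f) := rfl

/-- The capacity inequality, iterated. -/
theorem IsStable.le_iterDirDeriv [Fintype σ] {k : ℕ} (a : Fin k → σ → ℝ) (ha : ∀ j i, 0 < a j i)
    {f : MvPolynomial σ ℝ} (hs : IsStable f) (hf : f.IsHomogeneous k) {c : ℝ} (hc0 : 0 < c)
    (hc : ∀ w : σ → ℝ, (∀ i, 0 < w i) → ∀ x : Fin k → ℝ, (∀ j, 0 < x j) →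
      c * ∏ j, x j ≤ aeval (w + ∑ j, x j • a j) f) :
    c * Real.exp (-k) ≤ aeval (1 : σ → ℝ) (iterDirDeriv k a f) := by
  induction k generalizing f c with
  | zero => simpa [iterDirDeriv] using hc 1 (fun _ => one_pos) 0 (fun j => j.elim0)
  | succ k ih =>
    rw [iterDirDeriv_succ]
    have := ih (Fin.tail a) (fun j => ha j.succ) (hs.dirDeriv hf (ha 0)) (hf.dirDeriv (a 0))
      (c := c * Real.exp (-1)) (by positivity) ?_
    · refine le_trans (le_of_eq ?_) this
      rw [mul_assoc, ← Real.exp_add]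
      push_cast
      ring_nf
    intro w hw x hx
    -- The offset `w` keeps the base point positive even when no directions remain.
    have hb : ∀ i, 0 < (w + ∑ j, x j • Fin.tail a j) i := fun i => by
      rw [Pi.add_apply, Finset.sum_apply]
      exact add_pos_of_pos_of_nonneg (hw i) (Finset.sum_nonneg fun j _ =>
        mul_nonneg (hx j).le (ha j.succ i).le)
    have hline : ∀ v : σ → ℝ, (∀ i, 0 < v i) → ∀ t : ℝ, 0 < t → c * (∏ j, x j) * t ≤
        aeval (v + ∑ j, x j • Fin.tail a j + t • a 0) f := fun v hv t ht => by
      have h := hc v hv (Fin.cons t x) (fun j => Fin.cases ht hx j)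
      rw [Fin.prod_univ_succ, Fin.sum_univ_succ] at h
      simp only [Fin.cons_zero, Fin.cons_succ] at h
      convert! h using 1
      · ring
      · congr 2
        rw [add_assoc, add_comm (t • a 0)]
        rfl
    have hpos : 0 < aeval (w + ∑ j, x j • Fin.tail a j) f := by
      -- Moving a little of `w` into the direction `a 0` lets the growth bound itself prove
      -- positivity at the base point.
      obtain ⟨t, ht, hwt⟩ : ∃ t : ℝ, 0 < t ∧ ∀ i, 0 < (w - t • a 0) i := by
        have : ∀ᶠ t : ℝ in 𝓝[>] 0, ∀ i, 0 < (w - t • a 0) i := by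
          refine eventually_all.2 fun i => ?_
          have hcont : Tendsto (fun t : ℝ => (w - t • a 0) i) (𝓝[>] 0) (𝓝 (w i)) := by
            refine tendsto_nhdsWithin_of_tendsto_nhds ?_
            have : Continuous fun t : ℝ => (w - t • a 0) i := by
              simp only [Pi.sub_apply, Pi.smul_apply]
              fun_prop
            simpa using this.tendsto 0
          exact hcont.eventually (lt_mem_nhds (hw i))
        obtain ⟨t, h1, h2⟩ := (this.and self_mem_nhdsWithin).exists
        exact ⟨t, h2, h1⟩
      have h := hline _ hwt t ht
      have hx' : 0 < c * (∏ j, x j) * t :=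
        mul_pos (mul_pos hc0 (Finset.prod_pos fun j _ => hx j)) ht
      refine hx'.trans_le (h.trans (le_of_eq ?_))
      congr 2
      abel
    have h := hs.le_exp_one_mul_dirDeriv hf (ha 0) hb hpos (hline w hw)
    calc c * Real.exp (-1) * ∏ j, x j = Real.exp (-1) * (c * ∏ j, x j) := by ring
      _ ≤ Real.exp (-1) * (Real.exp 1 * _) := by gcongr
      _ = _ := by rw [← mul_assoc, ← Real.exp_add]; simp

theorem dirDeriv_prod_X [DecidableEq σ] (a : σ → ℝ) (S : Finset σ) :
    dirDeriv a (∏ i ∈ S, X i) = ∑ i ∈ S, a i • ∏ j ∈ S.erase i, (X j : MvPolynomial σ ℝ) := by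
  induction S using Finset.induction_on with
  | empty => simp
  | insert i S hi ih =>
    have hD : dirDeriv a (X i) = C (a i) := mkDerivation_X _ _ _
    rw [Finset.prod_insert hi, Derivation.leibniz, ih, hD, Finset.sum_insert hi,
      Finset.erase_insert hi, add_comm, smul_eq_mul, smul_eq_mul, Finset.mul_sum, smul_eq_C_mul,
      mul_comm]
    congr 1
    refine Finset.sum_congr rfl fun j hj => ?_
    have hij : i ≠ j := fun h => hi (h ▸ hj)
    rw [Finset.erase_insert_of_ne hij, Finset.prod_insert (by simp [hi]), mul_smul_comm]

-- Each derivative deletes one variable and contributes its coefficient; `g` records the order of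
-- deletion.
open Classical in
theorem iterDirDeriv_prod_X [Fintype σ] {k : ℕ} (a : Fin k → σ → ℝ) (S : Finset σ)
    (hS : S.card = k) : iterDirDeriv k a (∏ i ∈ S, X i) =
      C (∑ g : Fin k → σ, if g.Injective ∧ ∀ j, g j ∈ S then ∏ j, a j (g j) else 0) := by
  induction k generalizing S with
  | zero =>
    rw [Finset.card_eq_zero] at hS
    subst hS
    simp [iterDirDeriv, Function.injective_of_subsingleton]
  | succ k ih =>
    rw [iterDirDeriv_succ, dirDeriv_prod_X, map_sum,
      ← (Fin.consEquiv fun _ : Fin (k + 1) => σ).sum_comp, Fintype.sum_prod_type, map_sum,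
      ← Finset.sum_subset (Finset.subset_univ S)]
    · refine Finset.sum_congr rfl fun i hi => ?_
      rw [map_smul, ih _ _ (by rw [Finset.card_erase_of_mem hi, hS]; rfl), smul_eq_C_mul, ← C_mul,
        Finset.mul_sum]
      congr 1
      refine Finset.sum_congr rfl fun g _ => ?_
      rw [mul_ite, mul_zero]
      refine if_congr ?_ ?_ rfl
      · change _ ↔ (Fin.cons i g : Fin (k + 1) → σ).Injective ∧
          ∀ j, (Fin.cons i g : Fin (k + 1) → σ) j ∈ S
        simp only [Fin.cons_injective_iff, Set.mem_range, Fin.forall_fin_succ,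
          Fin.cons_zero, Fin.cons_succ, Finset.mem_erase]
        grind
      · simp [Fin.prod_univ_succ, Fin.tail]
    · intro i _ hi
      rw [← map_zero C]
      congr 1
      refine Finset.sum_eq_zero fun g _ => if_neg fun h => hi ?_
      simpa using h.2 0

end MvPolynomial

/-! ### Permanents of doubly stochastic matrices -/

namespace Matrix

open MvPolynomial

theorem exp_neg_le_permanent_fin {m : ℕ} {A : Matrix (Fin m) (Fin m) ℝ}
    (hA : A ∈ doublyStochastic ℝ (Fin m)) (hpos : ∀ i j, 0 < A i j) :
    Real.exp (-m) ≤ A.permanent := by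
  classical
  obtain ⟨h0, hrow, hcol⟩ := mem_doublyStochastic_iff_sum.1 hA
  have hhom : (∏ i : Fin m, (X i : MvPolynomial (Fin m) ℝ)).IsHomogeneous m := by
    have := IsHomogeneous.prod Finset.univ (fun i => (X i : MvPolynomial (Fin m) ℝ))
      (fun _ => 1) fun i _ => isHomogeneous_X _ i
    simpa using this
  have h := isStable_prod_X.le_iterDirDeriv (fun j i => A i j) (fun j i => hpos i j) hhom one_pos ?_
  · rw [iterDirDeriv_prod_X _ _ (by simp), one_mul] at h
    refine h.trans (le_of_eq ?_)
    simp only [Finset.mem_univ, implies_true, and_true, aeval_C, Algebra.algebraMap_self,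
      RingHom.id_apply]
    rw [← Finset.sum_filter, permanent]
    refine Finset.sum_bij' (fun g hg => Equiv.ofBijective g
      (Finite.injective_iff_bijective.1 (Finset.mem_filter.1 hg).2)) (fun p _ => p) ?_ ?_ ?_ ?_ ?_
    · simp
    · simp [Equiv.injective]
    · simp
    · intros; ext; simp
    · simp
  · intro w hw x hx
    rw [one_mul, map_prod]
    -- Column sums 1 split each `x j` over the rows; row sums 1 then allow weighted AM-GM in each
    -- row.
    calc ∏ j, x j = ∏ j, ∏ i, x j ^ A i j := by
          refine Finset.prod_congr rfl fun j _ => ?_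
          rw [← Real.rpow_sum_of_pos (hx j), hcol, Real.rpow_one]
      _ = ∏ i, ∏ j, x j ^ A i j := Finset.prod_comm
      _ ≤ ∏ i, aeval (w + ∑ j, x j • fun i => A i j) (X i) := by
          refine Finset.prod_le_prod (fun i _ => Finset.prod_nonneg fun j _ =>
            Real.rpow_nonneg (hx j).le _) fun i _ => ?_
          rw [aeval_X, Pi.add_apply, Finset.sum_apply]
          refine (Real.geom_mean_le_arith_mean_weighted Finset.univ (A i) x (fun j _ => h0 i j)
            (hrow i) fun j _ => (hx j).le).trans ?_
          have : ∑ j, A i j * x j = ∑ j, (x j • fun i => A i j) i :=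
            Finset.sum_congr rfl fun j _ => mul_comm _ _
          rw [this]
          linarith [hw i]

/-- The permanent of a doubly stochastic matrix of size `n` is at least `exp (-n)`. -/
theorem exp_neg_card_le_permanent {n : Type*} [Fintype n] [DecidableEq n] {A : Matrix n n ℝ}
    (hA : A ∈ doublyStochastic ℝ n) : Real.exp (-Fintype.card n) ≤ A.permanent := by
  rcases isEmpty_or_nonempty n with hn | hn
  · simp [permanent_isEmpty]
  set N : ℝ := (Fintype.card n : ℝ)
  have hN : 0 < N := Nat.cast_pos.2 Fintype.card_pos
  obtain ⟨h0, hrow, hcol⟩ := mem_doublyStochastic_iff_sum.1 hA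
  -- Mixing with the uniform matrix makes all entries positive, as the directions must be; then `t →
  -- 0`.
  let B : ℝ → Matrix n n ℝ := fun t => Matrix.of fun i j => (1 - t) * A i j + t * N⁻¹
  have hB : ∀ t ∈ Set.Ioo (0 : ℝ) 1, Real.exp (-N) ≤ (B t).permanent := by
    rintro t ⟨ht0, ht1⟩
    have hBpos : ∀ i j, 0 < B t i j := fun i j =>
      add_pos_of_nonneg_of_pos (mul_nonneg (by linarith) (h0 i j)) (by positivity)
    have hBd : B t ∈ doublyStochastic ℝ n := by
      refine mem_doublyStochastic_iff_sum.2 ⟨fun i j => (hBpos i j).le, fun i => ?_, fun j => ?_⟩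
      · simp only [B, of_apply, Finset.sum_add_distrib, ← Finset.mul_sum, hrow]
        simp [N]
      · simp only [B, of_apply, Finset.sum_add_distrib, ← Finset.mul_sum, hcol]
        simp [N]
    have e := Fintype.equivFin n
    have h := exp_neg_le_permanent_fin (reindex_mem_doublyStochastic (e₁ := e) (e₂ := e) hBd)
      (fun i j => hBpos _ _)
    refine h.trans (le_of_eq ?_)
    rw [permanent, permanent]
    refine Fintype.sum_equiv e.permCongr.symm _ _ fun p => ?_
    refine Fintype.prod_equiv e.symm _ _ fun i => ?_
    simp [Equiv.permCongr]
  have hcont : Continuous fun t => (B t).permanent := by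
    unfold permanent
    simp only [B, of_apply]
    fun_prop
  have hlim : Tendsto (fun t => (B t).permanent) (𝓝[>] 0) (𝓝 A.permanent) := by
    refine tendsto_nhdsWithin_of_tendsto_nhds ?_
    convert! hcont.tendsto 0 using 2
    congr 1
    ext i j
    simp [B]
  exact ge_of_tendsto hlim (eventually_of_mem (Ioo_mem_nhdsGT one_pos) hB)

end Matrix

/-! ### Counting perfect matchings of regular bipartite graphs -/

namespace SimpleGraph

variable {V : Type*} {G : SimpleGraph V} {p : V → Prop}

/-- The spanning subgraph whose edges join each `u` with `p u` to its image under `τ`. -/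
def Subgraph.ofEquivCompl (τ : {v // p v} ≃ {v // ¬ p v}) (hτ : ∀ u : {v // p v}, G.Adj u (τ u)) :
    G.Subgraph where
  verts := Set.univ
  Adj v w :=
    (∃ u : {v // p v}, v = u ∧ w = τ u) ∨ ∃ u : {v // p v}, w = u ∧ v = τ u
  adj_sub := by
    rintro v w (⟨u, rfl, rfl⟩ | ⟨u, rfl, rfl⟩)
    exacts [hτ u, (hτ u).symm]
  edge_vert _ := Set.mem_univ _
  symm := ⟨fun _ _ h => h.symm⟩

theorem Subgraph.ofEquivCompl_adj_iff {τ : {v // p v} ≃ {v // ¬ p v}} {hτ : ∀ u : {v // p v}, G.Adj u (τ u)}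
    (u : {v // p v}) (w : V) : (ofEquivCompl τ hτ).Adj u w ↔ w = τ u := by
  refine ⟨?_, fun h => Or.inl ⟨u, rfl, h⟩⟩
  rintro (⟨u', h, rfl⟩ | ⟨u', rfl, h⟩)
  · rw [Subtype.ext h]
  · exact absurd (h ▸ u.2) (τ u').2

theorem Subgraph.isPerfectMatching_ofEquivCompl (τ : {v // p v} ≃ {v // ¬ p v})
    (hτ : ∀ u : {v // p v}, G.Adj u (τ u)) : (ofEquivCompl τ hτ).IsPerfectMatching := by
  rw [isPerfectMatching_iff]
  intro v
  by_cases hv : p v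
  · exact ⟨τ ⟨v, hv⟩, Or.inl ⟨⟨v, hv⟩, rfl, rfl⟩, fun w hw =>
      (ofEquivCompl_adj_iff ⟨v, hv⟩ w).1 hw⟩
  · refine ⟨τ.symm ⟨v, hv⟩, Or.inr ⟨τ.symm ⟨v, hv⟩, rfl, by simp⟩, ?_⟩
    rintro w (⟨u, rfl, rfl⟩ | ⟨u, rfl, rfl⟩)
    · exact absurd u.2 hv
    · simp

theorem Subgraph.ofEquivCompl_injective :
    Function.Injective fun τ : {τ : {v // p v} ≃ {v // ¬ p v} // ∀ u : {v // p v}, G.Adj u (τ u)} =>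
      ofEquivCompl τ.1 τ.2 := fun τ τ' h => by
  refine Subtype.ext (Equiv.ext fun u => Subtype.ext ?_)
  have h1 : (ofEquivCompl τ.1 τ.2).Adj u (τ.1 u) := (ofEquivCompl_adj_iff u _).2 rfl
  have h2 : (ofEquivCompl τ'.1 τ'.2).Adj u (τ.1 u) := by
    change ofEquivCompl τ.1 τ.2 = ofEquivCompl τ'.1 τ'.2 at h
    rwa [← h]
  exact (ofEquivCompl_adj_iff u _).1 h2

variable [Fintype V] [DecidableRel G.Adj] {r : ℕ}

theorem IsRegularOfDegree.sum_ite_adj (hG : G.IsRegularOfDegree r) {q : V → Prop}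
    [DecidablePred q] {v : V} (hv : ∀ w, G.Adj v w → q w) (c : ℝ) :
    ∑ w : {w // q w}, (if G.Adj v w then c else 0) = r * c := by
  classical
  have h1 : ∑ w : {w // q w}, (if G.Adj v w then c else 0) =
      ∑ w, if G.Adj v w then c else 0 := by
    rw [← Finset.sum_subtype (Finset.univ.filter q) (by simp)
      fun w => if G.Adj v w then c else 0]
    refine Finset.sum_subset (Finset.subset_univ _) fun w _ hw => if_neg fun h => hw ?_
    simpa using hv w h
  rw [h1, ← Finset.sum_filter, Finset.sum_const, nsmul_eq_mul, ← hG v,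
    ← card_neighborFinset_eq_degree, neighborFinset_eq_filter]

/-- An `r`-regular bipartite graph on `n` vertices has at least `(r / e) ^ (n / 2)` perfect
matchings. -/
theorem IsRegularOfDegree.le_card_isPerfectMatching (hG : G.IsRegularOfDegree r) (hr : 0 < r)
    (hb : G.IsBipartite) : ((r : ℝ) / Real.exp 1) ^ ((Fintype.card V : ℝ) / 2) ≤
      Nat.card {M : G.Subgraph // M.IsPerfectMatching} := by
  classical
  obtain ⟨col⟩ := hb
  set p : V → Prop := fun v => col v = 0 with hp
  have hcol : ∀ v w, G.Adj v w → (p v ↔ ¬ p w) := fun v w h => by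
    have := col.valid h
    simp only [hp]
    omega
  have hr' : (0 : ℝ) < r := Nat.cast_pos.2 hr
  have sum1 : ∀ v : {v // p v}, ∑ w : {w // ¬ p w}, (if G.Adj v w then (r : ℝ)⁻¹ else 0) = 1 :=
    fun v => by
      rw [hG.sum_ite_adj (fun w h => (hcol _ _ h).1 v.2), mul_inv_cancel₀ hr'.ne']
  have sum2 : ∀ w : {w // ¬ p w}, ∑ v : {v // p v}, (if G.Adj v w then (r : ℝ)⁻¹ else 0) = 1 :=
    fun w => by
      simp_rw [G.adj_comm _ (w : V)]
      rw [hG.sum_ite_adj (fun v h => (hcol _ _ h.symm).2 w.2), mul_inv_cancel₀ hr'.ne']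
  -- Total weight, summed from either side, counts the vertices of that side.
  have hcard : Fintype.card {v // p v} = Fintype.card {v // ¬ p v} := by
    have h := Finset.sum_comm (s := (Finset.univ : Finset {v // p v}))
      (t := (Finset.univ : Finset {v // ¬ p v}))
      (f := fun v w => if G.Adj v w then (r : ℝ)⁻¹ else 0)
    simp only [sum1, sum2, Finset.sum_const, nsmul_eq_mul, mul_one, Finset.card_univ] at h
    exact_mod_cast h
  let e : {v // p v} ≃ {v // ¬ p v} := Fintype.equivOfCardEq hcard
  set m := Fintype.card {v // p v} with hm
  have hn : (Fintype.card V : ℝ) / 2 = m := by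
    have := Fintype.card_subtype_compl p
    have h2 := Fintype.card_subtype_le p
    have h3 : Fintype.card V = m + m := by omega
    rw [h3]; push_cast; ring
  -- The arbitrary bijection `e` only relabels the rows, making the matrix square over one index
  -- type.
  let A : Matrix {v // p v} {v // p v} ℝ :=
    Matrix.of fun u v => if G.Adj v (e u) then (r : ℝ)⁻¹ else 0
  have hA : A ∈ doublyStochastic ℝ {v // p v} := by
    refine mem_doublyStochastic_iff_sum.2 ⟨fun u v => ?_, fun u => sum2 (e u), fun v => ?_⟩
    · simp only [A, Matrix.of_apply]
      split_ifs <;> positivity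
    · exact (e.sum_comp fun w : {w // ¬ p w} => if G.Adj v w then (r : ℝ)⁻¹ else 0).trans (sum1 v)
  have hper : A.permanent = (r : ℝ)⁻¹ ^ m *
      Nat.card {τ : {v // p v} ≃ {v // ¬ p v} // ∀ u : {v // p v}, G.Adj u (τ u)} := by
    have h1 : ∀ σ : Equiv.Perm {v // p v}, ∏ i, A (σ i) i =
        if ∀ u : {v // p v}, G.Adj u (σ.trans e u) then (r : ℝ)⁻¹ ^ m else 0 := fun σ => by
      simp only [A, Matrix.of_apply, Equiv.trans_apply]
      rw [Finset.prod_ite_zero]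
      simp [hm]
    have h2 : ∑ σ : Equiv.Perm {v // p v},
        (if ∀ u : {v // p v}, G.Adj u (σ.trans e u) then (r : ℝ)⁻¹ ^ m else 0) =
        ∑ τ : {v // p v} ≃ {v // ¬ p v}, if ∀ u : {v // p v}, G.Adj u (τ u) then (r : ℝ)⁻¹ ^ m else 0 :=
      Fintype.sum_equiv ((Equiv.refl _).equivCongr e) _ _ fun σ => rfl
    rw [Matrix.permanent, Finset.sum_congr rfl fun σ _ => h1 σ, h2, ← Finset.sum_filter,
      Finset.sum_const, nsmul_eq_mul, mul_comm, Nat.card_eq_fintype_card, Fintype.card_subtype]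
  have hvdw := Matrix.exp_neg_card_le_permanent hA
  have hle : Nat.card {τ : {v // p v} ≃ {v // ¬ p v} // ∀ u : {v // p v}, G.Adj u (τ u)} ≤
      Nat.card {M : G.Subgraph // M.IsPerfectMatching} :=
    Nat.card_le_card_of_injective
      (fun τ => ⟨Subgraph.ofEquivCompl τ.1 τ.2, Subgraph.isPerfectMatching_ofEquivCompl τ.1 τ.2⟩)
      fun τ τ' h => Subgraph.ofEquivCompl_injective (congrArg Subtype.val h)
  rw [hn, Real.rpow_natCast, div_pow, ← Real.exp_nat_mul, mul_one]
  rw [hper, Real.exp_neg, inv_pow] at hvdw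
  refine le_trans ?_ (Nat.cast_le.2 hle)
  rw [div_eq_mul_inv]
  calc _ ≤ (r : ℝ) ^ m * (((r : ℝ) ^ m)⁻¹ * _) := by gcongr
    _ = _ := by rw [← mul_assoc, mul_inv_cancel₀ (by positivity), one_mul]

end SimpleGraph

theorem mainTheorem5 (c : ℝ) (e : ℕ → ℝ) (he : Tendsto e atTop (𝓝 0)) :
    ∃ f : ℕ → ℝ, f =o[atTop] (fun n : ℕ => (n : ℝ)) ∧
      ∀ (V : Type*) [Fintype V] (G : SimpleGraph V) [DecidableRel G.Adj] (n r : ℕ) (δ : ℝ),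
        Fintype.card V = n → |δ| ≤ e n → (r : ℝ) = (n : ℝ) ^ (c - δ) →
        G.IsBipartite → G.IsRegularOfDegree r →
        (n : ℝ) ^ (c / 2 * n - f n) ≤
          (Nat.card {M : G.Subgraph // M.IsPerfectMatching} : ℝ) := by
  -- The first term absorbs `δ`; the second rewrites `exp (-n / 2)` as a power of `n`.
  refine ⟨fun n => (e n / 2 + (2 * Real.log n)⁻¹) * n, ?_, ?_⟩
  · have h : Tendsto (fun n : ℕ => e n / 2 + (2 * Real.log n)⁻¹) atTop (𝓝 0) := by
      have h1 : Tendsto (fun n : ℕ => 2 * Real.log n) atTop atTop :=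
        (Real.tendsto_log_atTop.comp tendsto_natCast_atTop_atTop).const_mul_atTop two_pos
      simpa using (he.div_const 2).add h1.inv_tendsto_atTop
    simpa using ((isLittleO_one_iff ℝ).2 h).mul_isBigO (isBigO_refl (fun n : ℕ => (n : ℝ)) atTop)
  · intro V _ G _ n r δ hn hδ hr hb hG
    rcases Nat.eq_zero_or_pos n with rfl | hn0
    -- Here the left side is `0 ^ 0 = 1`, matched by the empty matching.
    · have := Fintype.card_eq_zero_iff.1 hn
      have : Nonempty {M : G.Subgraph // M.IsPerfectMatching} :=
        ⟨⊤, SimpleGraph.Subgraph.isPerfectMatching_iff.2 fun v => isEmptyElim v⟩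
      have h1 : 1 ≤ Nat.card {M : G.Subgraph // M.IsPerfectMatching} := Nat.card_pos
      simpa using h1
    have hnpos : (0 : ℝ) < n := Nat.cast_pos.2 hn0
    have hr0 : 0 < r := by
      rw [← Nat.cast_pos (α := ℝ), hr]
      positivity
    -- `0 < r < n` excludes `n = 1`, where `log n` would vanish.
    have hn1 : 1 < n := by
      obtain ⟨v⟩ : Nonempty V := Fintype.card_pos_iff.1 (hn ▸ hn0)
      have := G.degree_lt_card_verts v
      rw [hG v, hn] at this
      omega
    have hlog : 0 < Real.log n := Real.log_pos (by exact_mod_cast hn1)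
    refine le_trans ?_ (hG.le_card_isPerfectMatching hr0 hb)
    rw [hn, hr, Real.rpow_def_of_pos hnpos, Real.rpow_def_of_pos hnpos, ← Real.exp_sub,
      ← Real.exp_mul, Real.exp_le_exp]
    have h1 : Real.log n * (c / 2 * n - (e n / 2 + (2 * Real.log n)⁻¹) * n) =
        (Real.log n * (c - e n) - 1) * (n / 2) := by
      field_simp
      ring
    rw [h1]
    have := (le_abs_self δ).trans hδ
    gcongr
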